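/- **Proposition.** Let $\Omega\subset\mathbb{R}^3$ be a bounded convex domain (a nonempty, open, bounded, convex set) with boundary of class $C^2$ and with positive Gaussian curvature at every point of $\partial\Omega$. For $q\in\partial\Omega$ let $k_1(q)$ be the smaller of the two principal curvatures of $\partial\Omega$ at $q$, i.e. the smaller eigenvalue of the differential at $q$ of the outward unit normal field, acting on the tangent plane (so a sphere of radius $r$ has principal curvatures $1/r$). Then: 1. (Uniform interior sphere condition.) There is $r_1>0$ such that for every $q\in\partial\Omega$ there is $y\in\mathbb{R}^3$ with $B_{r_1}(y)\subset\Omega$ and $q\in\partial B_{r_1}(y)$. 2. (Uniform sphere-enclosing condition.) There is $R_1>0$ such that for every $q\in\partial\Omega$ there is $y'\in\mathbb{R}^3$ with $\Omega\subset B_{R_1}(y')$ and $q\in\partial B_{R_1}(y')$. 3. The minimum $\min_{\partial\Omega}k_1$ exists and is positive, and every $R_1>1/\min_{\partial\Omega}k_1$ is an admissible radius in 2. Here $B_r(y)$ denotes the open ball of radius $r$ centred at $y$. -/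

import Mathlib

open Set Filter Topology

noncomputable section

/-- Euclidean space `ℝ³`. -/
abbrev E3 : Type := EuclideanSpace ℝ (Fin 3)

/-- A bounded convex domain: nonempty, open, bounded and convex. -/
structure IsBoundedConvexDomain (Ω : Set E3) : Prop where
  nonempty : Ω.Nonempty
  isOpen : IsOpen Ω
  isBounded : Bornology.IsBounded Ω
  convex : Convex ℝ Ω

/-- `ρ` is a `C²` local defining function of `Ω` at `q`: it is of class `C²` near `q`, its
differential at `q` is nonzero, and `Ω` coincides with `{ρ < 0}` near `q`. -/
structure IsLocalDefiningFunction (Ω : Set E3) (q : E3) (ρ : E3 → ℝ) : Prop where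
  contDiffAt : ContDiffAt ℝ 2 ρ q
  gradient_ne_zero : gradient ρ q ≠ 0
  mem_iff : ∀ᶠ x in 𝓝 q, (x ∈ Ω ↔ ρ x < 0)

/-- `Ω` has a boundary of class `C²`. -/
def HasC2Boundary (Ω : Set E3) : Prop :=
  ∀ q ∈ frontier Ω, ∃ ρ : E3 → ℝ, IsLocalDefiningFunction Ω q ρ

/-- The normalized gradient `∇ρ / |∇ρ|`. If `ρ` is a local defining function of `Ω`, its
restriction to `∂Ω` is the outward unit normal, i.e. the Gauss map of `∂Ω`. -/
def unitGradient (ρ : E3 → ℝ) (x : E3) : E3 := ‖gradient ρ x‖⁻¹ • gradient ρ x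

/-- Some local defining function of `Ω` at `q` (if there is one). The quantities derived from it
below do not depend on which one it is, see `outwardNormal_eq` and `shapeOperator_apply`. -/
def localDefiningFunction (Ω : Set E3) (q : E3) : E3 → ℝ :=
  Classical.epsilon (IsLocalDefiningFunction Ω q)

/-- The outward unit normal `n(q)` of `∂Ω` at `q`. -/
def outwardNormal (Ω : Set E3) (q : E3) : E3 := unitGradient (localDefiningFunction Ω q) q

/-- The tangent plane of `∂Ω` at `q`, as a linear subspace of `ℝ³`. -/
abbrev tangentPlane (Ω : Set E3) (q : E3) : Submodule ℝ E3 := (Submodule.span ℝ {outwardNormal Ω q})ᗮ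

/-- The shape operator of `∂Ω` at `q`: the differential of the outward Gauss map, as an
endomorphism of the tangent plane. (The differential of a field of unit vectors takes values in
the tangent plane, so the projection only adjusts the codomain.) With this sign a sphere of
radius `r` has shape operator `1 / r`. -/
def shapeOperator (Ω : Set E3) (q : E3) : tangentPlane Ω q →ₗ[ℝ] tangentPlane Ω q :=
  ((tangentPlane Ω q).orthogonalProjectionOnto ∘L
    fderiv ℝ (unitGradient (localDefiningFunction Ω q)) q ∘L (tangentPlane Ω q).subtypeL :
      tangentPlane Ω q →L[ℝ] tangentPlane Ω q)

theorem IsLocalDefiningFunction.norm_unitGradient {Ω : Set E3} {q : E3} {ρ : E3 → ℝ}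
    (h : IsLocalDefiningFunction Ω q ρ) : ‖unitGradient ρ q‖ = 1 := by
  have := norm_ne_zero_iff.2 h.gradient_ne_zero
  simp [unitGradient, norm_smul, this]

theorem IsLocalDefiningFunction.contDiffAt_gradient {Ω : Set E3} {q : E3} {ρ : E3 → ℝ}
    (h : IsLocalDefiningFunction Ω q ρ) : ContDiffAt ℝ 1 (gradient ρ) q := by
  have h1 : ContDiffAt ℝ 1 (fderiv ℝ ρ) q := h.contDiffAt.fderiv_right (by norm_num)
  exact (InnerProductSpace.toDual ℝ E3).symm.toContinuousLinearEquiv.contDiff.contDiffAt.comp q h1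

theorem IsLocalDefiningFunction.contDiffAt_unitGradient {Ω : Set E3} {q : E3} {ρ : E3 → ℝ}
    (h : IsLocalDefiningFunction Ω q ρ) : ContDiffAt ℝ 1 (unitGradient ρ) q :=
  ((h.contDiffAt_gradient.norm ℝ h.gradient_ne_zero).inv
    (norm_ne_zero_iff.2 h.gradient_ne_zero)).smul h.contDiffAt_gradient

theorem IsLocalDefiningFunction.eventually {Ω : Set E3} {q : E3} {ρ : E3 → ℝ}
    (h : IsLocalDefiningFunction Ω q ρ) : ∀ᶠ x in 𝓝 q, IsLocalDefiningFunction Ω x ρ := by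
  filter_upwards [h.contDiffAt.eventually (by simp),
    h.contDiffAt_gradient.continuousAt.eventually_ne h.gradient_ne_zero,
    h.mem_iff.eventually_nhds] with x h1 h2 h3
  exact ⟨h1, h2, h3⟩

/-- A local defining function vanishes at a boundary point. -/
theorem IsLocalDefiningFunction.eq_zero {Ω : Set E3} {q : E3} {ρ : E3 → ℝ}
    (h : IsLocalDefiningFunction Ω q ρ) (hq : q ∈ frontier Ω) : ρ q = 0 := by
  have hc := h.contDiffAt.continuousAt
  rcases lt_trichotomy (ρ q) 0 with h0 | h0 | h0
  · have : Ω ∈ 𝓝 q := by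
      filter_upwards [h.mem_iff, hc.eventually_lt_const h0] with x h1 h2 using h1.2 h2
    exact absurd (mem_interior_iff_mem_nhds.2 this) hq.2
  · exact h0
  · have : ∀ᶠ x in 𝓝 q, x ∉ Ω := by
      filter_upwards [h.mem_iff, hc.eventually_const_lt h0] with x h1 h2 h3
      exact absurd (h1.1 h3) (not_lt.2 h2.le)
    exact absurd (mem_closure_iff_frequently.1 hq.1) (not_frequently.2 this)

theorem IsLocalDefiningFunction.hasDerivAt_line {Ω : Set E3} {q : E3} {ρ : E3 → ℝ}
    (h : IsLocalDefiningFunction Ω q ρ) (v : E3) :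
    HasDerivAt (fun t : ℝ => ρ (q + t • v)) (inner ℝ (gradient ρ q) v) 0 := by
  have h1 := (h.contDiffAt.differentiableAt (by norm_num)).hasGradientAt.hasFDerivAt
  have h2 : HasDerivAt (fun t : ℝ => q + t • v) v 0 := by
    simpa using ((hasDerivAt_id (0 : ℝ)).smul_const v).const_add q
  have h3 : HasFDerivAt ρ (InnerProductSpace.toDual ℝ E3 (gradient ρ q)) (q + (0 : ℝ) • v) := by
    simpa using h1
  exact h3.comp_hasDerivAt (0 : ℝ) h2

/-- The unit normal does not depend on the local defining function. -/
theorem IsLocalDefiningFunction.unitGradient_eq {Ω : Set E3} {q : E3} {ρ σ : E3 → ℝ}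
    (h : IsLocalDefiningFunction Ω q ρ) (h' : IsLocalDefiningFunction Ω q σ) (h0 : ρ q = 0) :
    unitGradient ρ q = unitGradient σ q := by
  have hn := norm_pos_iff.2 h.gradient_ne_zero
  have hn' := norm_pos_iff.2 h'.gradient_ne_zero
  have key : ∀ v : E3, inner ℝ (unitGradient ρ q) v < 0 → inner ℝ (unitGradient σ q) v ≤ 0 := by
    intro v hv
    have hv' : inner ℝ (gradient ρ q) v < 0 := by
      rw [unitGradient, real_inner_smul_left] at hv
      by_contra hcon
      exact absurd hv (not_lt.2 (mul_nonneg (inv_nonneg.2 hn.le) (not_lt.1 hcon)))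
    have hq : 0 ≤ σ q := by
      by_contra hcon
      have := h.mem_iff.self_of_nhds.1 (h'.mem_iff.self_of_nhds.2 (not_le.1 hcon))
      exact absurd this (by simp [h0])
    have t1 := (h.hasDerivAt_line v).tendsto_slope_zero_right
    have t2 := (h'.hasDerivAt_line v).tendsto_slope_zero_right
    have hline : Tendsto (fun t : ℝ => q + t • v) (𝓝[>] 0) (𝓝 q) := by
      have : Continuous fun t : ℝ => q + t • v := by fun_prop
      simpa using (this.tendsto 0).mono_left nhdsWithin_le_nhds
    have hσ : inner ℝ (gradient σ q) v ≤ 0 := by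
      refine le_of_tendsto t2 ?_
      filter_upwards [t1.eventually_lt_const hv', hline.eventually h.mem_iff,
        hline.eventually h'.mem_iff, self_mem_nhdsWithin] with t a b c ht
      have ht : 0 < t := ht
      simp only [zero_add, zero_smul, add_zero, h0, sub_zero, smul_eq_mul] at a ⊢
      have hρ : ρ (q + t • v) < 0 := by
        by_contra hcon
        exact absurd a (not_lt.2 (mul_nonneg (inv_nonneg.2 ht.le) (not_lt.1 hcon)))
      have := c.1 (b.2 hρ)
      exact mul_nonpos_of_nonneg_of_nonpos (inv_nonneg.2 ht.le) (by linarith)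
    rw [unitGradient, real_inner_smul_left]
    exact mul_nonpos_of_nonneg_of_nonpos (inv_nonneg.2 hn'.le) hσ
  have e1 := h.norm_unitGradient
  have e2 := h'.norm_unitGradient
  refine (inner_eq_one_iff_of_norm_eq_one (𝕜 := ℝ) e1 e2).1 ?_
  have hle : inner ℝ (unitGradient ρ q) (unitGradient σ q) ≤ 1 := by
    simpa [e1, e2] using real_inner_le_norm (unitGradient ρ q) (unitGradient σ q)
  by_contra hne
  have hlt := lt_of_le_of_ne hle hne
  have k := key (unitGradient σ q - unitGradient ρ q) (by
    rw [inner_sub_right, real_inner_self_eq_norm_sq, e1]; linarith)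
  rw [inner_sub_right, real_inner_self_eq_norm_sq, e2, real_inner_comm] at k
  linarith

/-- The differential of the Gauss map on tangent vectors does not depend on the local defining
function. -/
theorem IsLocalDefiningFunction.fderiv_unitGradient_eq {Ω : Set E3} {q : E3} {ρ σ : E3 → ℝ}
    (h : IsLocalDefiningFunction Ω q ρ) (h' : IsLocalDefiningFunction Ω q σ) (h0 : ρ q = 0)
    {v : E3} (hv : inner ℝ (unitGradient ρ q) v = 0) :
    fderiv ℝ (unitGradient ρ) q v = fderiv ℝ (unitGradient σ) q v := by
  have hs : HasStrictFDerivAt ρ (fderiv ℝ ρ q) q := h.contDiffAt.hasStrictFDerivAt (by norm_num)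
  have hne : fderiv ℝ ρ q ≠ 0 := by
    intro hz
    exact h.gradient_ne_zero (by simp [gradient, hz])
  have hr : (fderiv ℝ ρ q).range = ⊤ := by
    refine LinearMap.range_eq_top.2 (LinearMap.surjective ?_)
    intro hz
    exact hne (ContinuousLinearMap.coe_injective hz)
  have hmem : v ∈ (fderiv ℝ ρ q).ker := by
    have hn := norm_ne_zero_iff.2 h.gradient_ne_zero
    rw [unitGradient, real_inner_smul_left] at hv
    have : inner ℝ (gradient ρ q) v = 0 := by simpa [hn] using hv
    change fderiv ℝ ρ q v = 0
    rw [← toDual_gradient]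
    simpa using this
  set g := hs.implicitFunction ρ (fderiv ℝ ρ q) hr (ρ q) with hg
  have hg0 : g 0 = q := hs.implicitFunction_apply_image hr
  have hgd : HasFDerivAt g (fderiv ℝ ρ q).ker.subtypeL 0 :=
    (hs.to_implicitFunction hr).hasFDerivAt
  have hgt : Tendsto g (𝓝 0) (𝓝 q) := by simpa [hg0] using hgd.continuousAt.tendsto
  have hρ : ∀ᶠ s in 𝓝 (0 : (fderiv ℝ ρ q).ker), ρ (g s) = 0 := by
    have h1 := hs.map_implicitFunction_eq hr
    have h2 : Tendsto (fun s : (fderiv ℝ ρ q).ker => (ρ q, s)) (𝓝 0) (𝓝 (ρ q, 0)) :=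
      (Continuous.prodMk_right (ρ q)).tendsto 0
    filter_upwards [h2.eventually h1] with s hs'
    simpa [h0, hg] using hs'
  have heq : (fun s => unitGradient ρ (g s)) =ᶠ[𝓝 0] fun s => unitGradient σ (g s) := by
    filter_upwards [hρ, hgt.eventually h.eventually, hgt.eventually h'.eventually] with s a b c
    exact b.unitGradient_eq c a
  have d1 : HasFDerivAt (unitGradient ρ) (fderiv ℝ (unitGradient ρ) q) (g 0) := by
    rw [hg0]; exact (h.contDiffAt_unitGradient.differentiableAt (by norm_num)).hasFDerivAt
  have d2 : HasFDerivAt (unitGradient σ) (fderiv ℝ (unitGradient σ) q) (g 0) := by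
    rw [hg0]; exact (h'.contDiffAt_unitGradient.differentiableAt (by norm_num)).hasFDerivAt
  have c1 := d1.comp 0 hgd
  have c2 := (d2.comp 0 hgd).congr_of_eventuallyEq heq
  have := congrArg (fun L => L ⟨v, hmem⟩) (c1.unique c2)
  simpa using this

theorem localDefiningFunction_spec {Ω : Set E3} {q : E3} {ρ : E3 → ℝ}
    (h : IsLocalDefiningFunction Ω q ρ) :
    IsLocalDefiningFunction Ω q (localDefiningFunction Ω q) :=
  Classical.epsilon_spec (p := IsLocalDefiningFunction Ω q) ⟨ρ, h⟩

/-- The outward unit normal can be computed from any local defining function. -/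
theorem outwardNormal_eq {Ω : Set E3} {q : E3} {ρ : E3 → ℝ} (hq : q ∈ frontier Ω)
    (h : IsLocalDefiningFunction Ω q ρ) : outwardNormal Ω q = unitGradient ρ q :=
  ((h.unitGradient_eq (localDefiningFunction_spec h) (h.eq_zero hq))).symm

/-- The shape operator can be computed from any local defining function. -/
theorem shapeOperator_apply {Ω : Set E3} {q : E3} {ρ : E3 → ℝ} (hq : q ∈ frontier Ω)
    (h : IsLocalDefiningFunction Ω q ρ) (v : tangentPlane Ω q) :
    shapeOperator Ω q v =
      (tangentPlane Ω q).orthogonalProjectionOnto (fderiv ℝ (unitGradient ρ) q v) := by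
  have hv : inner ℝ (unitGradient ρ q) (v : E3) = 0 := by
    rw [← outwardNormal_eq hq h]
    exact Submodule.mem_orthogonal_singleton_iff_inner_right.1 v.2
  rw [h.fderiv_unitGradient_eq (localDefiningFunction_spec h) (h.eq_zero hq) hv]
  rfl

/-- The Gaussian curvature of `∂Ω` at `q`. -/
def gaussianCurvature (Ω : Set E3) (q : E3) : ℝ := LinearMap.det (shapeOperator Ω q)

/-- The smaller principal curvature `k₁(q)` of `∂Ω` at `q`: the smallest eigenvalue of the (self-adjoint) shape
operator. -/
def smallerPrincipalCurvature (Ω : Set E3) (q : E3) : ℝ :=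
  sInf {k : ℝ | Module.End.HasEigenvalue (shapeOperator Ω q) k}

/-- `∂Ω` is of class `C²` and of positive Gaussian curvature. -/
structure PositiveCurvatureCondition (Ω : Set E3) : Prop where
  hasC2Boundary : HasC2Boundary Ω
  gaussianCurvature_pos : ∀ q ∈ frontier Ω, 0 < gaussianCurvature Ω q

/-- Every boundary point of `Ω` lies on a sphere of radius `r` whose open ball is inside `Ω`. -/
def InteriorSphereConditionWith (Ω : Set E3) (r : ℝ) : Prop :=
  ∀ q ∈ frontier Ω, ∃ y : E3, Metric.ball y r ⊆ Ω ∧ q ∈ Metric.sphere y r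

/-- Every boundary point of `Ω` lies on a sphere of radius `R` whose open ball contains `Ω`. -/
def SphereEnclosingConditionWith (Ω : Set E3) (R : ℝ) : Prop :=
  ∀ q ∈ frontier Ω, ∃ y : E3, Ω ⊆ Metric.ball y R ∧ q ∈ Metric.sphere y R

/-- The uniform interior sphere condition. -/
def UniformInteriorSphereCondition (Ω : Set E3) : Prop :=
  ∃ r : ℝ, 0 < r ∧ InteriorSphereConditionWith Ω r

/-- The uniform sphere-enclosing condition. -/
def UniformSphereEnclosingCondition (Ω : Set E3) : Prop :=
  ∃ R : ℝ, 0 < R ∧ SphereEnclosingConditionWith Ω R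

end

/-! The enclosing condition is Blaschke's rolling theorem. If the second fundamental form is at
least `k` and `r > 1 / k`, a second-order Taylor expansion places the domain, near each boundary
point, inside the ball of radius `r` tangent there; the strict inequality leaves room for the
remainder (`eventually_mem_closedBall`).

The passage from local to global goes through the support function h of the closure. Local
containment says that r‖u‖ - h(u) has, near every u ≠ 0, a linear minorant touching it at u
(`eventually_inner_le_of_local`), so it behaves as a convex function on segments avoiding the
origin. Subtracting a linear functional gives the difference between the support functions of a
fixed tangent ball and of the body. It vanishes at the normal n of the contact point and is
nonnegative near n, hence it stays nonnegative along segments issuing from n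
(`nonneg_of_locally_supported`). This is the containment of the body in the ball
(`subset_closedBall_of_local`); h need not be differentiable.

The minimum of k₁ is that of the second fundamental form over the compact unit tangent bundle. It is
positive because convexity makes the form semidefinite and the Gaussian curvature excludes the
eigenvalue 0. The interior condition only needs a locally Lipschitz gradient and compactness of the
boundary. -/

/-- A continuous function on `[0, 1]` which has a local affine minorant touching it at each point
of `(0, 1)` and which is minorized by `0` near `0` is nonnegative at `1`. -/
theorem nonneg_of_locally_supported {φ : ℝ → ℝ} (hc : ContinuousOn φ (Icc 0 1)) (h0 : φ 0 = 0)
    (hnear : ∀ᶠ t in 𝓝 (0 : ℝ), 0 ≤ φ t)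
    (hs : ∀ t ∈ Ioo (0 : ℝ) 1, ∃ s, ∀ᶠ t' in 𝓝 t, φ t + s * (t' - t) ≤ φ t') : 0 ≤ φ 1 := by
  by_contra! hneg
  -- Since `φ 1 < 0`, this adds a strictly convex term, so the touching minorants become strictly
  -- convex and forbid an interior maximum. The factor 1/2 keeps `ψ 1` negative, while `ψ` is
  -- positive just to the right of 0, so the maximum is interior.
  set ψ : ℝ → ℝ := fun t => φ t - φ 1 / 2 * t ^ 2 with hψ
  have hψc : ContinuousOn ψ (Icc 0 1) := hc.sub (by fun_prop)
  obtain ⟨t₀, ht₀, hmax⟩ := isCompact_Icc.exists_isMaxOn (nonempty_Icc.2 zero_le_one) hψc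
  obtain ⟨t₁, ⟨hn₁, hlt₁⟩, hpos₁⟩ : ∃ t : ℝ, (0 ≤ φ t ∧ t < 1) ∧ 0 < t :=
    ((((hnear.and (eventually_lt_nhds one_pos)).filter_mono nhdsWithin_le_nhds).and
      (self_mem_nhdsWithin : ∀ᶠ t in 𝓝[>] (0 : ℝ), 0 < t))).exists
  have hψ₀ : 0 < ψ t₀ := by
    have h1 : ψ t₁ ≤ ψ t₀ := hmax ⟨hpos₁.le, hlt₁.le⟩
    have h2 : 0 < ψ t₁ := by simp only [hψ]; nlinarith [pow_pos hpos₁ 2]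
    exact h2.trans_le h1
  have hpos : 0 < t₀ := by
    refine lt_of_le_of_ne ht₀.1 ?_
    rintro rfl
    simp [hψ, h0] at hψ₀
  have hlt : t₀ < 1 := by
    refine lt_of_le_of_ne ht₀.2 ?_
    rintro rfl
    simp only [hψ] at hψ₀
    linarith
  obtain ⟨s, hs⟩ := hs t₀ ⟨hpos, hlt⟩
  have key : ∀ᶠ t in 𝓝 t₀, (s - φ 1 * t₀) * (t - t₀) - φ 1 / 2 * (t - t₀) ^ 2 ≤ 0 := by
    filter_upwards [hs, Icc_mem_nhds hpos hlt] with t h1 h2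
    have h3 : ψ t ≤ ψ t₀ := hmax h2
    simp only [hψ] at h3
    nlinarith
  rcases le_total 0 (s - φ 1 * t₀) with hσ | hσ
  · obtain ⟨t, h1, h2⟩ := ((key.filter_mono nhdsWithin_le_nhds).and
      (self_mem_nhdsWithin : ∀ᶠ t in 𝓝[>] t₀, t₀ < t)).exists
    nlinarith [mul_nonneg hσ (sub_pos.2 h2).le, pow_pos (sub_pos.2 h2) 2]
  · obtain ⟨t, h1, h2⟩ := ((key.filter_mono nhdsWithin_le_nhds).and
      (self_mem_nhdsWithin : ∀ᶠ t in 𝓝[<] t₀, t < t₀)).exists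
    nlinarith [mul_nonneg_of_nonpos_of_nonpos hσ (sub_neg.2 h2).le, pow_pos (sub_pos.2 h2) 2]

/-! ### Support functions and the rolling theorem -/

section Support

variable {E : Type*} [NormedAddCommGroup E] [InnerProductSpace ℝ E]

theorem mem_closedBall_sub_smul_iff {p x n : E} {r : ℝ} (hr : 0 ≤ r) (hn : ‖n‖ = 1) :
    x ∈ Metric.closedBall (p - r • n) r ↔ ‖x - p‖ ^ 2 + 2 * r * inner ℝ (x - p) n ≤ 0 := by
  have h : ‖x - (p - r • n)‖ ^ 2 = ‖x - p‖ ^ 2 + 2 * r * inner ℝ (x - p) n + r ^ 2 := by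
    rw [show x - (p - r • n) = (x - p) + r • n by abel, norm_add_sq_real, inner_smul_right,
      norm_smul, hn, Real.norm_eq_abs, mul_one, sq_abs]
    ring
  rw [mem_closedBall_iff_norm, ← sq_le_sq₀ (norm_nonneg _) hr, h]
  constructor <;> intro h <;> linarith

/-- If a convex set lies near its point `p` in the ball of radius `r` tangent at `p` to the
hyperplane orthogonal to `n`, then its support function near `n` is at most that of the ball. -/
theorem eventually_inner_le_of_local {K : Set E} (hK : Convex ℝ K) {p n : E} {r : ℝ} (hr : 0 < r)
    (hp : p ∈ K) (hn : ‖n‖ = 1)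
    (hloc : ∀ᶠ x in 𝓝 p, x ∈ K → x ∈ Metric.closedBall (p - r • n) r) :
    ∀ᶠ u in 𝓝 n, ∀ x ∈ K, inner ℝ (x - p) u ≤ r * (‖u‖ - inner ℝ n u) := by
  obtain ⟨δ, hδ, hloc⟩ := Metric.eventually_nhds_iff.1 hloc
  -- Points of `K` close to `p` lie in the ball, and Cauchy–Schwarz suffices. Any other point is
  -- seen from `p` in a direction whose component along `n` is at most `-δ / (4 * r)`, by convexity,
  -- so tilting `n` by less than this keeps the left side nonpositive.
  refine Metric.eventually_nhds_iff.2 ⟨δ / (4 * r), by positivity, fun u hu x hx => ?_⟩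
  rw [dist_eq_norm] at hu
  by_cases hxδ : dist x p < δ
  · have h1 := hloc hxδ hx
    rw [mem_closedBall_iff_norm, show x - (p - r • n) = (x - p) + r • n by abel] at h1
    have h2 := real_inner_le_norm ((x - p) + r • n) u
    rw [inner_add_left, real_inner_smul_left] at h2
    have := mul_le_mul_of_nonneg_right h1 (norm_nonneg u)
    linarith
  · have hd : δ ≤ ‖x - p‖ := by rw [← dist_eq_norm]; exact not_lt.1 hxδ
    have hd0 : 0 < ‖x - p‖ := hδ.trans_le hd
    -- Moves `x` towards `p` to distance `δ / 2`, where the local hypothesis applies.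
    set t : ℝ := δ / (2 * ‖x - p‖) with ht
    have ht0 : 0 < t := by positivity
    have ht1 : t ≤ 1 := by rw [ht, div_le_one (by positivity)]; linarith
    have hz : p + t • (x - p) ∈ K := hK.add_smul_sub_mem hp hx ⟨ht0.le, ht1⟩
    have hzn : ‖p + t • (x - p) - p‖ = δ / 2 := by
      rw [add_sub_cancel_left, norm_smul, Real.norm_of_nonneg ht0.le, ht]
      field_simp
    have h1 := (mem_closedBall_sub_smul_iff hr.le hn).1
      (hloc (by rw [dist_eq_norm, hzn]; linarith) hz)
    rw [hzn, add_sub_cancel_left, real_inner_smul_left] at h1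
    have h2 : inner ℝ (x - p) n ≤ -(δ / (4 * r)) * ‖x - p‖ := by
      have h3 : 2 * r * (t * inner ℝ (x - p) n) = (r * δ) * (inner ℝ (x - p) n / ‖x - p‖) := by
        rw [ht]; field_simp
      rw [h3] at h1
      rw [← div_le_iff₀ hd0]
      have h4 : r * δ * (inner ℝ (x - p) n / ‖x - p‖ + δ / (4 * r)) ≤ 0 := by
        have : r * δ * (δ / (4 * r)) = (δ / 2) ^ 2 := by field_simp; norm_num
        linarith
      have := nonpos_of_mul_nonpos_right h4 (by positivity)
      linarith
    have h5 : inner ℝ (x - p) (u - n) ≤ ‖x - p‖ * (δ / (4 * r)) :=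
      (real_inner_le_norm _ _).trans (mul_le_mul_of_nonneg_left hu.le hd0.le)
    rw [inner_sub_right] at h5
    have h6 := real_inner_le_norm n u
    rw [hn, one_mul] at h6
    have := mul_nonneg hr.le (sub_nonneg.2 h6)
    linarith

/-- **Blaschke's rolling theorem** in terms of local tangent balls: if a compact convex set is, near
each boundary point, contained in the ball of radius `r` tangent at that point, then it is
contained in each of these balls. -/
theorem subset_closedBall_of_local {K : Set E} (hK : Convex ℝ K) (hKc : IsCompact K) {r : ℝ}
    (hr : 0 < r)
    (hloc : ∀ n : E, ‖n‖ = 1 → ∀ p ∈ K, (∀ x ∈ K, inner ℝ x n ≤ inner ℝ p n) →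
      ∀ᶠ x in 𝓝 p, x ∈ K → x ∈ Metric.closedBall (p - r • n) r)
    {p n w : E} (hn : ‖n‖ = 1) (hp : p ∈ K) (hpn : ∀ x ∈ K, inner ℝ x n ≤ inner ℝ p n)
    (hw : w ≠ 0) (hnw : inner ℝ n w = 0) : K ⊆ Metric.closedBall (p - r • n) r := by
  have hmax : ∀ u : E, ∃ g ∈ K, ∀ x ∈ K, inner ℝ x u ≤ inner ℝ g u := fun u =>
    hKc.exists_isMaxOn ⟨p, hp⟩ (f := fun x => inner ℝ x u) (by fun_prop)
  choose g hgK hg using hmax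
  have hloc' : ∀ u : E, u ≠ 0 → ∀ q ∈ K, (∀ x ∈ K, inner ℝ x u ≤ inner ℝ q u) →
      ∀ᶠ v in 𝓝 u, ∀ x ∈ K, inner ℝ (x - q) v ≤ r * (‖v‖ - inner ℝ (‖u‖⁻¹ • u) v) := by
    intro u hu q hq hqm
    have hu' : 0 < ‖u‖ := norm_pos_iff.2 hu
    have h1 : ‖‖u‖⁻¹ • u‖ = 1 := norm_smul_inv_norm hu
    have h2 := eventually_inner_le_of_local hK hr hq h1 (hloc _ h1 q hq fun x hx => by
      rw [inner_smul_right, inner_smul_right]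
      exact mul_le_mul_of_nonneg_left (hqm x hx) (by positivity))
    have h3 : Tendsto (fun v : E => ‖u‖⁻¹ • v) (𝓝 u) (𝓝 (‖u‖⁻¹ • u)) :=
      (continuous_const_smul _).tendsto u
    filter_upwards [h3.eventually h2] with v hv x hx
    have h4 := hv x hx
    rw [inner_smul_right, inner_smul_right (‖u‖⁻¹ • u), norm_smul,
      Real.norm_of_nonneg (by positivity : 0 ≤ ‖u‖⁻¹)] at h4
    have h5 : ‖u‖⁻¹ * inner ℝ (x - q) v ≤ ‖u‖⁻¹ * (r * (‖v‖ - inner ℝ (‖u‖⁻¹ • u) v)) := by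
      linarith
    exact le_of_mul_le_mul_left h5 (by positivity)
  obtain ⟨M, hM⟩ := hKc.isBounded.exists_norm_le
  have hM0 : 0 ≤ M := (norm_nonneg p).trans (hM p hp)
  -- The maximizer `g` need not be continuous, but the support function is Lipschitz with constant a
  -- norm bound of `K`.
  have hgc : Continuous fun u => inner ℝ (g u) u := by
    refine (LipschitzWith.of_le_add_mul (K := M.toNNReal) fun u v => ?_).continuous
    rw [Real.coe_toNNReal M hM0]
    have h1 := hg v (g u) (hgK u)
    have h2 := real_inner_le_norm (g u) (u - v)
    rw [inner_sub_right, ← dist_eq_norm] at h2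
    have := mul_le_mul_of_nonneg_right (hM (g u) (hgK u)) (dist_nonneg (x := u) (y := v))
    linarith
  -- The vector `w` certifies that the segment from `n` to `v` misses the origin, where there is no
  -- local support.
  have key : ∀ w : E, inner ℝ n w = 0 → ∀ x ∈ K, ∀ v : E, 0 < inner ℝ v w →
      inner ℝ (x - (p - r • n)) v ≤ r * ‖v‖ := by
    intro w hnw x hx v hv
    set c : ℝ → E := fun t => n + t • (v - n) with hc
    have hcc : Continuous c := by fun_prop
    have hc0 : ∀ t ∈ Ioo (0 : ℝ) 1, c t ≠ 0 := by
      intro t ht h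
      have h1 : inner ℝ (c t) w = t * inner ℝ v w := by
        simp only [hc, inner_add_left, real_inner_smul_left, inner_sub_left, hnw]; ring
      rw [h, inner_zero_left] at h1
      exact (mul_pos ht.1 hv).ne h1
    have hφ := nonneg_of_locally_supported
      (φ := fun t => r * ‖c t‖ - inner ℝ (g (c t)) (c t) - inner ℝ (r • n - p) (c t))
      (((continuous_const.mul hcc.norm).sub (hgc.comp hcc)).sub
        (continuous_const.inner hcc)).continuousOn ?_ ?_ ?_
    · have hc1 : c 1 = v := by simp [hc]
      simp only [hc1] at hφ
      have h1 := hg v x hx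
      simp only [inner_sub_left] at hφ ⊢
      linarith
    · have hc1 : c 0 = n := by simp [hc]
      have h1 : inner ℝ (g n) n = inner ℝ p n := le_antisymm (hpn _ (hgK n)) (hg n p hp)
      simp only [hc1, h1, inner_sub_left, real_inner_smul_left, real_inner_self_eq_norm_sq, hn]
      ring
    · have h1 := hloc' n (by rintro rfl; simp at hn) p hp hpn
      have h2 : Tendsto c (𝓝 0) (𝓝 n) := by simpa [hc] using hcc.tendsto 0
      filter_upwards [h2.eventually h1] with t ht
      have h3 := ht (g (c t)) (hgK _)
      simp only [hn, inv_one, one_smul, inner_sub_left, real_inner_smul_left] at h3 ⊢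
      linarith
    · intro t ht
      have h1 := hloc' (c t) (hc0 t ht) (g (c t)) (hgK _) (hg _)
      -- Slope along the segment of the linear functional supporting the difference of support
      -- functions at `c t`.
      refine ⟨inner ℝ ((r * ‖c t‖⁻¹) • c t - g (c t) - (r • n - p)) (v - n), ?_⟩
      filter_upwards [hcc.continuousAt.eventually h1] with t' ht'
      have h3 := ht' (g (c t')) (hgK _)
      have h4 : c t' = c t + (t' - t) • (v - n) := by simp only [hc]; module
      have h5 : r * ‖c t‖ = inner ℝ ((r * ‖c t‖⁻¹) • c t) (c t) := by
        have := norm_ne_zero_iff.2 (hc0 t ht)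
        rw [real_inner_smul_left, real_inner_self_eq_norm_sq]
        field_simp
      have h6 : inner ℝ ((r * ‖c t‖⁻¹) • c t - g (c t) - (r • n - p)) (c t') =
          inner ℝ ((r * ‖c t‖⁻¹) • c t - g (c t) - (r • n - p)) (c t) +
          inner ℝ ((r * ‖c t‖⁻¹) • c t - g (c t) - (r • n - p)) (v - n) * (t' - t) := by
        rw [h4, inner_add_right, inner_smul_right]; ring
      have h7 : inner ℝ ((r * ‖c t‖⁻¹) • c t) (c t') = r * inner ℝ (‖c t‖⁻¹ • c t) (c t') := by
        rw [mul_smul, real_inner_smul_left]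
      rw [inner_sub_left, inner_sub_left, inner_sub_left, inner_sub_left (_ - _) (r • n - p) (c t),
        inner_sub_left _ (g (c t)) (c t), ← h5, h7] at h6
      rw [inner_sub_left] at h3
      have h8 : inner ℝ (r • n - p) (c t') = inner ℝ (r • n) (c t') - inner ℝ p (c t') :=
        inner_sub_left _ _ _
      linarith
  intro x hx
  set y := x - (p - r • n) with hy
  -- Testing the support inequality in the direction `y` itself yields `‖y‖ ≤ r`. If `y` is
  -- orthogonal to `w`, that direction is reached as a limit of `y + t • w`; replacing `w` by `-w`
  -- covers the other half-space.
  have key' : ∀ w : E, w ≠ 0 → 0 ≤ inner ℝ y w →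
      (∀ v : E, 0 < inner ℝ v w → inner ℝ y v ≤ r * ‖v‖) → inner ℝ y y ≤ r * ‖y‖ := by
    intro w hw h1 h2
    have hc : Tendsto (fun t : ℝ => y + t • w) (𝓝[>] 0) (𝓝 y) := by
      have : Continuous fun t : ℝ => y + t • w := by fun_prop
      simpa using (this.tendsto 0).mono_left nhdsWithin_le_nhds
    refine le_of_tendsto_of_tendsto (tendsto_const_nhds.inner hc) (hc.norm.const_mul r) ?_
    filter_upwards [self_mem_nhdsWithin] with t ht
    refine h2 _ ?_
    rw [inner_add_left, real_inner_smul_left]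
    exact add_pos_of_nonneg_of_pos h1 (mul_pos ht (real_inner_self_pos.2 hw))
  have hfin : inner ℝ y y ≤ r * ‖y‖ := by
    rcases le_total 0 (inner ℝ y w) with h | h
    · exact key' w hw h (key w hnw x hx)
    · exact key' (-w) (neg_ne_zero.2 hw) (by rw [inner_neg_right]; linarith)
        (key (-w) (by rw [inner_neg_right, hnw, neg_zero]) x hx)
  rw [real_inner_self_eq_norm_sq] at hfin
  rw [mem_closedBall_iff_norm]
  by_contra! hcon
  nlinarith [norm_nonneg y]

end Support

/-! ### Local geometry at a boundary point -/

/-- Scalar estimate: `a` is minus the normal component and `s` the length of `x - q`. -/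
theorem sq_le_two_mul_of_taylor {g k r N a s Q β γ : ℝ} (hg : 0 < g) (hk : 0 < k) (hr : 0 < r)
    (hN : 0 ≤ N) (ha : 0 ≤ a) (has : a ≤ s)
    (hQ : g * k * (s ^ 2 - a ^ 2) ≤ Q + 2 * a * β + a ^ 2 * γ)
    (hβ : β ≤ N * s) (hγ : γ ≤ N) (hT : -(g * (r * k - 1) / (4 * r) * s ^ 2) ≤ g * a - Q / 2)
    (hs : s < g * (r * k - 1) / (g * k + 3 * N)) : s ^ 2 ≤ 2 * r * a := by
  have hC : 0 < g * k + 3 * N := by positivity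
  have b1 : a ^ 2 * γ ≤ a ^ 2 * N := mul_le_mul_of_nonneg_left hγ (sq_nonneg a)
  have b2 : a * a ≤ a * s := mul_le_mul_of_nonneg_left has ha
  have b3 : a * a * N ≤ a * s * N := mul_le_mul_of_nonneg_right b2 hN
  have b4 : a * β ≤ a * (N * s) := mul_le_mul_of_nonneg_left hβ ha
  have b5 : g * k * (a * a) ≤ g * k * (a * s) := mul_le_mul_of_nonneg_left b2 (by positivity)
  -- All errors from the normal component carry a factor `a * s`, and the smallness of `s` bounds
  -- them by `a * (g * (r * k - 1))`. The Taylor tolerance is chosen so that `g * (r * k + 1)` then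
  -- appears on both sides in `b11` and cancels.
  have b6 : g * k * s ^ 2 - a * (s * (g * k + 3 * N)) ≤ Q := by linarith
  have b7 : a * (s * (g * k + 3 * N)) ≤ a * (g * (r * k - 1)) :=
    mul_le_mul_of_nonneg_left ((lt_div_iff₀ hC).1 hs).le ha
  have b8 : g * (r * k - 1) / (4 * r) * s ^ 2 * (4 * r) = g * (r * k - 1) * s ^ 2 := by
    field_simp
  generalize g * (r * k - 1) / (4 * r) * s ^ 2 = e at hT b8
  have b9 : g * k * s ^ 2 - 2 * e ≤ 2 * g * a + a * (g * (r * k - 1)) := by linarith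
  have b10 := mul_le_mul_of_nonneg_left b9 (by positivity : 0 ≤ 2 * r)
  have b11 : g * (r * k + 1) * s ^ 2 ≤ g * (r * k + 1) * (2 * r * a) := by linarith
  exact le_of_mul_le_mul_left b11 (by positivity)

namespace IsLocalDefiningFunction

variable {Ω : Set E3} {q : E3} {ρ : E3 → ℝ}

theorem norm_gradient_pos (h : IsLocalDefiningFunction Ω q ρ) : 0 < ‖gradient ρ q‖ :=
  norm_pos_iff.2 h.gradient_ne_zero

theorem gradient_eq_smul (h : IsLocalDefiningFunction Ω q ρ) :
    gradient ρ q = ‖gradient ρ q‖ • unitGradient ρ q := by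
  rw [unitGradient, smul_inv_smul₀ h.norm_gradient_pos.ne']

theorem hasFDerivAt_gradient (h : IsLocalDefiningFunction Ω q ρ) :
    HasFDerivAt (gradient ρ) (fderiv ℝ (gradient ρ) q) q :=
  (h.contDiffAt_gradient.differentiableAt (by norm_num)).hasFDerivAt

theorem hasFDerivAt (h : IsLocalDefiningFunction Ω q ρ) :
    HasFDerivAt ρ (innerSL ℝ (gradient ρ q)) q :=
  (h.contDiffAt.differentiableAt (by norm_num)).hasGradientAt.hasFDerivAt

/-- The Hessian of a local defining function is symmetric. -/
theorem inner_fderiv_gradient_comm (h : IsLocalDefiningFunction Ω q ρ) (v w : E3) :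
    inner ℝ (fderiv ℝ (gradient ρ) q v) w = inner ℝ v (fderiv ℝ (gradient ρ) q w) := by
  have h1 : fderiv ℝ ρ = fun x => innerSL ℝ (gradient ρ x) := by
    funext x
    ext y
    simp [inner_gradient_left]
  have h2 : HasFDerivAt (fderiv ℝ ρ) ((innerSL ℝ (E := E3)) ∘L fderiv ℝ (gradient ρ) q) q := by
    rw [h1]
    exact (innerSL ℝ (E := E3)).hasFDerivAt.comp q h.hasFDerivAt_gradient
  have h3 := h.contDiffAt.isSymmSndFDerivAt (by simp) v w
  rw [h2.fderiv] at h3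
  change inner ℝ (fderiv ℝ (gradient ρ) q v) w = inner ℝ (fderiv ℝ (gradient ρ) q w) v at h3
  rw [h3, real_inner_comm]

/-- The second order Taylor expansion of a local defining function. -/
theorem eventually_taylor (h : IsLocalDefiningFunction Ω q ρ) {ε : ℝ} (hε : 0 < ε) :
    ∀ᶠ x in 𝓝 q, |ρ x - ρ q - inner ℝ (gradient ρ q) (x - q) -
      inner ℝ (fderiv ℝ (gradient ρ) q (x - q)) (x - q) / 2| ≤ ε * ‖x - q‖ ^ 2 := by
  set A := fderiv ℝ (gradient ρ) q with hA
  have h1 := h.hasFDerivAt_gradient.isLittleO.def hε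
  obtain ⟨δ, hδ, H⟩ := Metric.eventually_nhds_iff_ball.1 (h1.and h.eventually)
  refine Metric.eventually_nhds_iff_ball.2 ⟨δ, hδ, fun x hx => ?_⟩
  -- The mean value inequality is applied to the remainder: its gradient is the first-order
  -- remainder of `gradient ρ`, thanks to the symmetry of the Hessian.
  set θ : E3 → ℝ := fun x => ρ x - inner ℝ (gradient ρ q) (x - q) -
      inner ℝ (A (x - q)) (x - q) / 2 with hθ
  have hd : ∀ z ∈ Metric.closedBall q ‖x - q‖, HasFDerivWithinAt θ
      (innerSL ℝ (gradient ρ z - gradient ρ q - A (z - q))) (Metric.closedBall q ‖x - q‖) z := by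
    intro z hz
    have hzδ : z ∈ Metric.ball q δ := by
      rw [mem_ball_iff_norm] at hx ⊢
      exact (mem_closedBall_iff_norm.1 hz).trans_lt hx
    have d1 := (H z hzδ).2.hasFDerivAt
    have d0 : HasFDerivAt (fun x : E3 => x - q) (ContinuousLinearMap.id ℝ E3) z :=
      (hasFDerivAt_id z).sub_const q
    have d2 := (innerSL ℝ (gradient ρ q)).hasFDerivAt.comp z d0
    have d3 := (A.hasFDerivAt.comp z d0).inner ℝ d0
    refine HasFDerivAt.hasFDerivWithinAt ?_
    refine ((d1.sub d2).sub (d3.mul_const (1 / 2))).congr_fderiv ?_ |>.congr_of_eventuallyEq ?_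
    · ext y
      have := h.inner_fderiv_gradient_comm y (z - q)
      rw [← hA] at this
      simp [-map_sub, inner_sub_left, this, real_inner_comm]
      ring
    · refine Eventually.of_forall fun y => ?_
      simp [hθ]
      ring
  have hb : ∀ z ∈ Metric.closedBall q ‖x - q‖,
      ‖innerSL ℝ (gradient ρ z - gradient ρ q - A (z - q))‖ ≤ ε * ‖x - q‖ := by
    intro z hz
    have hzδ : z ∈ Metric.ball q δ := by
      rw [mem_ball_iff_norm] at hx ⊢
      exact (mem_closedBall_iff_norm.1 hz).trans_lt hx
    rw [innerSL_apply_norm]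
    exact (H z hzδ).1.trans (mul_le_mul_of_nonneg_left (mem_closedBall_iff_norm.1 hz) hε.le)
  have := (convex_closedBall q ‖x - q‖).norm_image_sub_le_of_norm_hasFDerivWithin_le hd hb
    (Metric.mem_closedBall_self (norm_nonneg _)) (mem_closedBall_iff_norm.2 le_rfl)
  simp only [hθ, sub_self, map_zero, inner_zero_right, zero_div, sub_zero, Real.norm_eq_abs] at this
  convert this using 1
  · congr 1; ring
  · ring

/-- The second fundamental form in terms of the Hessian of a local defining function. -/
theorem inner_fderiv_unitGradient (h : IsLocalDefiningFunction Ω q ρ) (v : E3) {w : E3}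
    (hw : inner ℝ (unitGradient ρ q) w = 0) :
    inner ℝ (fderiv ℝ (unitGradient ρ) q v) w =
      ‖gradient ρ q‖⁻¹ * inner ℝ (fderiv ℝ (gradient ρ) q v) w := by
  have hG : inner ℝ (gradient ρ q) w = 0 := by
    rw [h.gradient_eq_smul, real_inner_smul_left, hw, mul_zero]
  have h1 : DifferentiableAt ℝ (fun x => ‖gradient ρ x‖⁻¹) q :=
    ((h.contDiffAt_gradient.norm ℝ h.gradient_ne_zero).inv
      h.norm_gradient_pos.ne').differentiableAt (by norm_num)
  have h2 := (h1.hasFDerivAt.smul h.hasFDerivAt_gradient).fderiv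
  change inner ℝ (fderiv ℝ (fun x => ‖gradient ρ x‖⁻¹ • gradient ρ x) q v) w = _
  change fderiv ℝ (fun x => ‖gradient ρ x‖⁻¹ • gradient ρ x) q = _ at h2
  rw [h2]
  simp [inner_add_left, real_inner_smul_left, hG]

/-- The segment from `q` to a point of `Ω` runs inside `Ω`, where `ρ` is negative, so `ρ` cannot
increase to first order along it. Thus the tangent plane supports `Ω`. -/
theorem inner_gradient_sub_nonpos (h : IsLocalDefiningFunction Ω q ρ) (hq : q ∈ frontier Ω)
    (hΩ : Convex ℝ Ω) (hΩo : IsOpen Ω) {x : E3} (hx : x ∈ Ω) :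
    inner ℝ (gradient ρ q) (x - q) ≤ 0 := by
  by_contra! hpos
  have t1 := (h.hasDerivAt_line (x - q)).tendsto_slope_zero_right
  have hline : Tendsto (fun t : ℝ => q + t • (x - q)) (𝓝[>] 0) (𝓝 q) := by
    have : Continuous fun t : ℝ => q + t • (x - q) := by fun_prop
    simpa using (this.tendsto 0).mono_left nhdsWithin_le_nhds
  obtain ⟨t, ⟨⟨h1, h2⟩, h3⟩, ht⟩ := (((t1.eventually_const_lt hpos).and
    (hline.eventually h.mem_iff)).and
      ((eventually_lt_nhds one_pos).filter_mono nhdsWithin_le_nhds) |>.and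
        (self_mem_nhdsWithin : ∀ᶠ t in 𝓝[>] (0 : ℝ), 0 < t)).exists
  have hm : q + t • (x - q) ∈ Ω := by
    have := hΩ.add_smul_sub_mem_interior' hq.1 (hΩo.interior_eq.symm ▸ hx) ⟨ht, h3.le⟩
    rwa [hΩo.interior_eq] at this
  have h4 := h2.1 hm
  simp only [zero_add, zero_smul, add_zero, h.eq_zero hq, sub_zero, smul_eq_mul] at h1
  exact absurd h1 (not_lt.2 (mul_nonpos_of_nonneg_of_nonpos (inv_nonneg.2 ht.le) h4.le))

/-- The second fundamental form of a convex domain is positive semidefinite. -/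
theorem inner_fderiv_gradient_nonneg (h : IsLocalDefiningFunction Ω q ρ) (hq : q ∈ frontier Ω)
    (hΩ : Convex ℝ Ω) (hΩo : IsOpen Ω) {v : E3} (hv : inner ℝ (unitGradient ρ q) v = 0) :
    0 ≤ inner ℝ (fderiv ℝ (gradient ρ) q v) v := by
  by_contra! hneg
  have hG : inner ℝ (gradient ρ q) v = 0 := by
    rw [h.gradient_eq_smul, real_inner_smul_left, hv, mul_zero]
  have hv0 : 0 < ‖v‖ := by
    rw [norm_pos_iff]; rintro rfl; simp at hneg
  set a := inner ℝ (fderiv ℝ (gradient ρ) q v) v with ha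
  -- With this tolerance, negative curvature along `v` gives `ρ ≤ a * s ^ 2 / 4 < 0` at both points
  -- `q ± t • v`; their midpoint `q` would then lie in the open set `Ω`.
  have hε : 0 < -a / (4 * ‖v‖ ^ 2) := div_pos (neg_pos.2 hneg) (by positivity)
  have hmem : ∀ᶠ t in 𝓝[>] (0 : ℝ), ∀ s : ℝ, s = t ∨ s = -t → q + s • v ∈ Ω := by
    have H := (h.eventually_taylor hε).and h.mem_iff
    have c1 : Tendsto (fun t : ℝ => q + t • v) (𝓝[>] 0) (𝓝 q) := by
      have : Continuous fun t : ℝ => q + t • v := by fun_prop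
      simpa using (this.tendsto 0).mono_left nhdsWithin_le_nhds
    have c2 : Tendsto (fun t : ℝ => q + (-t) • v) (𝓝[>] 0) (𝓝 q) := by
      have : Continuous fun t : ℝ => q + (-t) • v := by fun_prop
      simpa using (this.tendsto 0).mono_left nhdsWithin_le_nhds
    filter_upwards [c1.eventually H, c2.eventually H, self_mem_nhdsWithin] with t h1 h2 ht s hs
    have ht : 0 < t := ht
    have h3 : (|ρ (q + s • v) - ρ q - inner ℝ (gradient ρ q) (q + s • v - q) -
        inner ℝ (fderiv ℝ (gradient ρ) q (q + s • v - q)) (q + s • v - q) / 2| ≤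
        -a / (4 * ‖v‖ ^ 2) * ‖q + s • v - q‖ ^ 2) ∧ (q + s • v ∈ Ω ↔ ρ (q + s • v) < 0) := by
      rcases hs with rfl | rfl
      exacts [h1, h2]
    have hs2 : 0 < s ^ 2 := by rcases hs with rfl | rfl <;> simp [ht.ne', sq_pos_iff]
    refine h3.2.2 ?_
    have h4 := (abs_le.1 h3.1).2
    rw [add_sub_cancel_left, h.eq_zero hq, map_smul, real_inner_smul_left, inner_smul_right,
      inner_smul_right, hG, ← ha, norm_smul, mul_pow, Real.norm_eq_abs, sq_abs] at h4
    have h5 : -a / (4 * ‖v‖ ^ 2) * (s ^ 2 * ‖v‖ ^ 2) = -a / 4 * s ^ 2 := by field_simp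
    rw [h5] at h4
    nlinarith [mul_pos_of_neg_of_neg hneg (neg_neg_of_pos hs2)]
  obtain ⟨t, ht⟩ := hmem.exists
  have h1 := hΩ (ht t (Or.inl rfl)) (ht (-t) (Or.inr rfl)) (by norm_num : (0 : ℝ) ≤ 1 / 2)
    (by norm_num : (0 : ℝ) ≤ 1 / 2) (by norm_num)
  have h2 : (1 / 2 : ℝ) • (q + t • v) + (1 / 2 : ℝ) • (q + (-t) • v) = q := by module
  rw [h2] at h1
  exact hq.2 (by rwa [hΩo.interior_eq])

/-- A domain whose second fundamental form at `q` exceeds `1 / r` lies near `q` in the ball of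
radius `r` tangent to the boundary at `q`. -/
theorem eventually_mem_closedBall (h : IsLocalDefiningFunction Ω q ρ) (hq : q ∈ frontier Ω)
    (hΩ : Convex ℝ Ω) (hΩo : IsOpen Ω) {k r : ℝ} (hk : 0 < k) (hr : 1 / k < r)
    (hA : ∀ v : E3, inner ℝ (unitGradient ρ q) v = 0 →
      ‖gradient ρ q‖ * k * ‖v‖ ^ 2 ≤ inner ℝ (fderiv ℝ (gradient ρ) q v) v) :
    ∀ᶠ x in 𝓝 q, x ∈ closure Ω → x ∈ Metric.closedBall (q - r • unitGradient ρ q) r := by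
  set ν := unitGradient ρ q with hν
  set g := ‖gradient ρ q‖ with hg
  set A := fderiv ℝ (gradient ρ) q with hAdef
  have hν1 : ‖ν‖ = 1 := h.norm_unitGradient
  have hg0 : 0 < g := h.norm_gradient_pos
  have hr0 : 0 < r := (by positivity : (0 : ℝ) < 1 / k).trans hr
  have hrk : 0 < g * (r * k - 1) := by
    rw [div_lt_iff₀ hk] at hr
    exact mul_pos hg0 (by linarith)
  set C := g * k + 3 * ‖A‖ with hC
  have hC0 : 0 < C := by positivity
  have hε : 0 < g * (r * k - 1) / (4 * r) := by positivity
  have hη : 0 < g * (r * k - 1) / C := by positivity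
  obtain ⟨δ, hδ, H⟩ := Metric.eventually_nhds_iff_ball.1 (((h.eventually_taylor hε).and
    h.mem_iff).and (Metric.ball_mem_nhds q hη))
  have key : Ω ∩ Metric.ball q δ ⊆ Metric.closedBall (q - r • ν) r := by
    rintro x ⟨hx, hxδ⟩
    obtain ⟨⟨h1, h2⟩, h3⟩ := H x hxδ
    have h4 := (abs_le.1 h1).1
    have h5 := h2.1 hx
    have h6 := h.inner_gradient_sub_nonpos hq hΩ hΩo hx
    rw [mem_closedBall_sub_smul_iff hr0.le hν1]
    rw [dist_eq_norm] at h3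
    rw [h.eq_zero hq] at h4
    set v := x - q with hv
    rw [h.gradient_eq_smul, real_inner_smul_left, ← hg, ← hν] at h4 h6
    rw [real_inner_comm]
    obtain ⟨a, ha⟩ : ∃ a : ℝ, a = -inner ℝ ν v := ⟨_, rfl⟩
    have ha' : inner ℝ ν v = -a := by rw [ha, neg_neg]
    rw [ha'] at h4 h6 ⊢
    have ha0 : 0 ≤ a := by nlinarith
    have hav : a ≤ ‖v‖ := by
      have := abs_real_inner_le_norm ν v
      rw [hν1, one_mul, ha', abs_neg, abs_of_nonneg ha0] at this
      exact this
    have hνν : inner ℝ ν ν = (1 : ℝ) := by rw [real_inner_self_eq_norm_sq, hν1, one_pow]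
    -- The Hessian bound holds only for tangent vectors, so it is applied to the tangential part of
    -- `v`.
    have h7 := hA (v + a • ν) (by rw [inner_add_right, inner_smul_right, hνν, ha']; ring)
    have h8 : ‖v + a • ν‖ ^ 2 = ‖v‖ ^ 2 - a ^ 2 := by
      rw [norm_add_sq_real, inner_smul_right, real_inner_comm, ha', norm_smul, hν1,
        Real.norm_eq_abs, mul_one, sq_abs]
      ring
    have h9 : inner ℝ (A (v + a • ν)) (v + a • ν) = inner ℝ (A v) v +
        2 * a * inner ℝ (A v) ν + a ^ 2 * inner ℝ (A ν) ν := by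
      have : inner ℝ (A ν) v = inner ℝ (A v) ν := by
        rw [h.inner_fderiv_gradient_comm ν v, real_inner_comm]
      simp only [map_add, map_smul, inner_add_left, inner_add_right, real_inner_smul_left,
        inner_smul_right, this]
      ring
    have b1 : inner ℝ (A v) ν ≤ ‖A‖ * ‖v‖ := by
      have := real_inner_le_norm (A v) ν
      rw [hν1, mul_one] at this
      exact this.trans (A.le_opNorm v)
    have b2 : inner ℝ (A ν) ν ≤ ‖A‖ := by
      have := real_inner_le_norm (A ν) ν
      rw [hν1, mul_one] at this
      simpa [hν1] using this.trans (A.le_opNorm ν)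
    rw [h8, h9] at h7
    have b3 : -(g * (r * k - 1) / (4 * r) * ‖v‖ ^ 2) ≤ g * a - inner ℝ (A v) v / 2 := by linarith
    have := sq_le_two_mul_of_taylor hg0 hk hr0 (norm_nonneg A) ha0 hav h7 b1 b2 b3 h3
    linarith
  filter_upwards [Metric.ball_mem_nhds q hδ] with x hxδ hx
  have h1 := Metric.isOpen_ball.closure_inter (s := Ω) ⟨hx, hxδ⟩
  exact closure_minimal key Metric.isClosed_closedBall h1

/-- A boundary point where a linear functional attains its maximum has the corresponding outward
normal. -/
theorem unitGradient_eq_of_isMaxOn (h : IsLocalDefiningFunction Ω q ρ) (hq : q ∈ frontier Ω)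
    {u : E3} (hu : ‖u‖ = 1) (hmax : ∀ x ∈ Ω, inner ℝ x u ≤ inner ℝ q u) :
    unitGradient ρ q = u := by
  refine (inner_eq_one_iff_of_norm_eq_one (𝕜 := ℝ) h.norm_unitGradient hu).1 ?_
  have hle : inner ℝ (unitGradient ρ q) u ≤ 1 := by
    simpa [h.norm_unitGradient, hu] using real_inner_le_norm (unitGradient ρ q) u
  by_contra hne
  have hlt := lt_of_le_of_ne hle hne
  -- If the unit vectors differed, moving along `w` would enter `Ω` and increase the functional at
  -- once.
  set w := u - unitGradient ρ q with hw
  have hGw : inner ℝ (gradient ρ q) w < 0 := by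
    rw [h.gradient_eq_smul, real_inner_smul_left, hw, inner_sub_right,
      real_inner_self_eq_norm_sq, h.norm_unitGradient]
    exact mul_neg_of_pos_of_neg h.norm_gradient_pos (by linarith)
  have hwu : 0 < inner ℝ w u := by
    rw [hw, inner_sub_left, real_inner_self_eq_norm_sq, hu]
    linarith
  have t1 := (h.hasDerivAt_line w).tendsto_slope_zero_right
  have hline : Tendsto (fun t : ℝ => q + t • w) (𝓝[>] 0) (𝓝 q) := by
    have : Continuous fun t : ℝ => q + t • w := by fun_prop
    simpa using (this.tendsto 0).mono_left nhdsWithin_le_nhds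
  obtain ⟨t, ⟨h1, h2⟩, ht⟩ := (((t1.eventually_lt_const hGw).and
    (hline.eventually h.mem_iff)).and
      (self_mem_nhdsWithin : ∀ᶠ t in 𝓝[>] (0 : ℝ), 0 < t)).exists
  simp only [zero_add, zero_smul, add_zero, h.eq_zero hq, sub_zero, smul_eq_mul] at h1
  have h3 : ρ (q + t • w) < 0 := by
    by_contra hcon
    exact absurd h1 (not_lt.2 (mul_nonneg (inv_nonneg.2 ht.le) (not_lt.1 hcon)))
  have h4 := hmax _ (h2.2 h3)
  rw [inner_add_left, real_inner_smul_left] at h4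
  linarith [mul_pos ht hwu]

/-- The interior sphere condition holds uniformly near a boundary point of class `C²`. -/
theorem eventually_ball_subset (h : IsLocalDefiningFunction Ω q ρ) :
    ∃ r₀ : ℝ, 0 < r₀ ∧ ∀ᶠ p in 𝓝 q, p ∈ frontier Ω → ∀ r, 0 < r → r ≤ r₀ →
      Metric.ball (p - r • outwardNormal Ω p) r ⊆ Ω := by
  obtain ⟨K, s, hs, hK⟩ := h.contDiffAt_gradient.exists_lipschitzOnWith
  set g := ‖gradient ρ q‖ with hg
  have hg0 : 0 < g := h.norm_gradient_pos
  have hgt : ∀ᶠ x in 𝓝 q, g / 2 < ‖gradient ρ x‖ :=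
    h.contDiffAt_gradient.continuousAt.norm.eventually_const_lt (by linarith)
  obtain ⟨δ, hδ, H⟩ := Metric.eventually_nhds_iff_ball.1 ((h.eventually.and hgt).and hs)
  have hK0 : (0 : ℝ) ≤ K := K.2
  -- The first bound keeps a ball of diameter `2 * r` touching `p` within `δ` of `q`. The second
  -- gives `2 * r * K ≤ ‖gradient ρ p‖`, so the Lipschitz error cannot outweigh the normal term; `K
  -- + 1` avoids division by zero.
  refine ⟨min (δ / 4) (g / (4 * (K + 1))), by positivity, ?_⟩
  filter_upwards [Metric.ball_mem_nhds q (half_pos hδ)] with p hp hpf r hr hr₀ y hy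
  have hpδ : p ∈ Metric.ball q δ := Metric.ball_subset_ball (by linarith) hp
  have hρp := (H p hpδ).1.1
  rw [outwardNormal_eq hpf hρp] at hy
  have hν := hρp.norm_unitGradient
  have hyp : ‖y - p‖ < δ / 2 := by
    have h1 : ‖y - (p - r • unitGradient ρ p)‖ < r := mem_ball_iff_norm.1 hy
    have h2 : ‖y - p‖ ≤ ‖y - (p - r • unitGradient ρ p)‖ + ‖r • unitGradient ρ p‖ := by
      have := norm_sub_le (y - (p - r • unitGradient ρ p)) (r • unitGradient ρ p)
      rwa [show y - (p - r • unitGradient ρ p) - r • unitGradient ρ p = y - p by abel] at this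
    rw [norm_smul, hν, mul_one, Real.norm_of_nonneg hr.le] at h2
    have := hr₀.trans (min_le_left _ _)
    linarith
  have hsub : Metric.closedBall p ‖y - p‖ ⊆ Metric.ball q δ := by
    refine Metric.closedBall_subset_ball' ?_
    have := Metric.mem_ball.1 hp
    linarith
  have hyδ : y ∈ Metric.ball q δ := hsub (mem_closedBall_iff_norm.2 le_rfl)
  refine (H y hyδ).1.1.mem_iff.self_of_nhds.2 ?_
  have hmv := (convex_closedBall p ‖y - p‖).norm_image_sub_le_of_norm_hasFDerivWithin_le'
    (f := ρ) (f' := fun z => innerSL ℝ (gradient ρ z)) (φ := innerSL ℝ (gradient ρ p))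
    (C := K * ‖y - p‖)
    (fun z hz => (H z (hsub hz)).1.1.hasFDerivAt.hasFDerivWithinAt)
    (fun z hz => by
      rw [← map_sub, innerSL_apply_norm]
      exact (hK.norm_sub_le (H z (hsub hz)).2 (H p hpδ).2).trans
        (mul_le_mul_of_nonneg_left (mem_closedBall_iff_norm.1 hz) hK0))
    (Metric.mem_closedBall_self (norm_nonneg _)) (mem_closedBall_iff_norm.2 le_rfl)
  rw [hρp.eq_zero hpf, sub_zero, innerSL_apply_apply, hρp.gradient_eq_smul, real_inner_smul_left,
    Real.norm_eq_abs] at hmv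
  have hmv' := (abs_le.1 hmv).2
  have h1 : ‖y - p‖ ^ 2 + 2 * r * inner ℝ (unitGradient ρ p) (y - p) < 0 := by
    rw [mem_ball_iff_norm, show y - (p - r • unitGradient ρ p) =
      (y - p) + r • unitGradient ρ p by abel, ← sq_lt_sq₀ (norm_nonneg _) hr.le, norm_add_sq_real,
      inner_smul_right, norm_smul, hν, Real.norm_eq_abs, mul_one, sq_abs, real_inner_comm] at hy
    linarith
  have h2 : 2 * r * K ≤ ‖gradient ρ p‖ := by
    have e1 := hr₀.trans (min_le_right _ _)
    rw [le_div_iff₀ (by positivity)] at e1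
    have e2 := (H p hpδ).1.2
    nlinarith
  have h3 : 2 * r * ρ y < 0 := by
    have e1 := mul_le_mul_of_nonneg_left hmv' (by positivity : 0 ≤ 2 * r)
    have e2 := mul_lt_mul_of_pos_left h1 hρp.norm_gradient_pos
    have e3 := mul_le_mul_of_nonneg_right h2 (sq_nonneg ‖y - p‖)
    nlinarith
  exact (pos_iff_neg_of_mul_neg h3).1 (by positivity)

end IsLocalDefiningFunction

/-! ### Rayleigh quotients -/

section Rayleigh

variable {V : Type*} [NormedAddCommGroup V] [InnerProductSpace ℝ V] [FiniteDimensional ℝ V]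
  [Nontrivial V] {T : V →ₗ[ℝ] V}

/-- The smallest eigenvalue of a positive semidefinite operator is the minimum of its Rayleigh
quotient. -/
theorem LinearMap.IsSymmetric.sInf_eigenvalues_spec (hT : T.IsSymmetric)
    (hpos : ∀ v, 0 ≤ inner ℝ (T v) v) :
    Module.End.HasEigenvalue T (sInf {k : ℝ | Module.End.HasEigenvalue T k}) ∧
      ∀ v, sInf {k : ℝ | Module.End.HasEigenvalue T k} * ‖v‖ ^ 2 ≤ inner ℝ (T v) v := by
  have h1 := hT.hasEigenvalue_iInf_of_finiteDimensional
  set i : ℝ := ⨅ x : {x : V // x ≠ 0}, RCLike.re (inner ℝ (T x) x) / ‖(x : V)‖ ^ 2 with hi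
  -- Semidefiniteness serves only to bound the quotients below, so that the real infimum is a
  -- genuine lower bound.
  have hbdd : BddBelow (Set.range fun x : {x : V // x ≠ 0} =>
      (RCLike.re (inner ℝ (T x) x) / ‖(x : V)‖ ^ 2 : ℝ)) := by
    refine ⟨0, ?_⟩
    rintro _ ⟨x, rfl⟩
    exact div_nonneg (hpos x) (sq_nonneg _)
  have hle : ∀ v, i * ‖v‖ ^ 2 ≤ inner ℝ (T v) v := by
    intro v
    rcases eq_or_ne v 0 with rfl | hv
    · simp
    · exact (le_div_iff₀ (by positivity)).1 (ciInf_le hbdd ⟨v, hv⟩)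
  have hleast : IsLeast {k : ℝ | Module.End.HasEigenvalue T k} i := by
    refine ⟨h1, fun k hk => ?_⟩
    obtain ⟨v, hv⟩ := hk.exists_hasEigenvector
    have h2 := hle v
    rw [hv.apply_eq_smul, real_inner_smul_left, real_inner_self_eq_norm_sq] at h2
    exact le_of_mul_le_mul_right h2 (pow_pos (norm_pos_iff.2 hv.2) 2)
  rw [hleast.csInf_eq]
  exact ⟨h1, hle⟩

end Rayleigh

/-! ### Principal curvatures along the boundary -/

section Boundary

variable {Ω : Set E3} {q : E3} {ρ : E3 → ℝ}

theorem IsLocalDefiningFunction.outwardNormal_ne_zero (h : IsLocalDefiningFunction Ω q ρ)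
    (hq : q ∈ frontier Ω) : outwardNormal Ω q ≠ 0 := by
  rw [outwardNormal_eq hq h, ← norm_ne_zero_iff, h.norm_unitGradient]
  exact one_ne_zero

theorem mem_tangentPlane_iff {v : E3} :
    v ∈ tangentPlane Ω q ↔ inner ℝ (outwardNormal Ω q) v = 0 :=
  Submodule.mem_orthogonal_singleton_iff_inner_right

theorem finrank_orthogonal_span_singleton_E3 {v : E3} (hv : v ≠ 0) :
    Module.finrank ℝ (Submodule.span ℝ {v})ᗮ = 2 := by
  have : Fact (Module.finrank ℝ E3 = 2 + 1) := ⟨by simp⟩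
  exact Submodule.finrank_orthogonal_span_singleton hv

theorem exists_ne_zero_inner_eq_zero {v : E3} (hv : v ≠ 0) : ∃ w : E3, w ≠ 0 ∧ inner ℝ v w = 0 := by
  have : Nontrivial (Submodule.span ℝ {v})ᗮ :=
    Module.nontrivial_of_finrank_eq_succ (finrank_orthogonal_span_singleton_E3 hv)
  obtain ⟨w, hw⟩ := exists_ne (0 : (Submodule.span ℝ {v})ᗮ)
  exact ⟨w, fun h => hw (Subtype.ext h), Submodule.mem_orthogonal_singleton_iff_inner_right.1 w.2⟩

/-- Pairing with a tangent vector hides the projection, so the second fundamental form is the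
Hessian of any local defining function divided by the length of its gradient. -/
theorem IsLocalDefiningFunction.inner_shapeOperator (h : IsLocalDefiningFunction Ω q ρ)
    (hq : q ∈ frontier Ω) (v w : tangentPlane Ω q) :
    inner ℝ (shapeOperator Ω q v) w =
      ‖gradient ρ q‖⁻¹ * inner ℝ (fderiv ℝ (gradient ρ) q v) (w : E3) := by
  rw [shapeOperator_apply hq h, Submodule.inner_orthogonalProjectionOnto_eq_of_mem_right,
    h.inner_fderiv_unitGradient]
  rw [← outwardNormal_eq hq h]
  exact mem_tangentPlane_iff.1 w.2

theorem IsLocalDefiningFunction.shapeOperator_isSymmetric (h : IsLocalDefiningFunction Ω q ρ)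
    (hq : q ∈ frontier Ω) : (shapeOperator Ω q).IsSymmetric := by
  intro v w
  rw [real_inner_comm (shapeOperator Ω q w), h.inner_shapeOperator hq, h.inner_shapeOperator hq,
    h.inner_fderiv_gradient_comm, real_inner_comm]

/-- At a boundary point of positive Gaussian curvature of a convex domain, the smaller principal
curvature is positive and is the minimum of the second fundamental form on unit tangent vectors. -/
theorem IsLocalDefiningFunction.smallerPrincipalCurvature_spec (h : IsLocalDefiningFunction Ω q ρ)
    (hq : q ∈ frontier Ω) (hΩ : Convex ℝ Ω) (hΩo : IsOpen Ω) (hdet : 0 < gaussianCurvature Ω q) :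
    0 < smallerPrincipalCurvature Ω q ∧
      (∀ v : E3, inner ℝ (outwardNormal Ω q) v = 0 → smallerPrincipalCurvature Ω q * ‖v‖ ^ 2 ≤
        ‖gradient ρ q‖⁻¹ * inner ℝ (fderiv ℝ (gradient ρ) q v) v) ∧
      ∃ v : E3, inner ℝ (outwardNormal Ω q) v = 0 ∧ ‖v‖ = 1 ∧
        smallerPrincipalCurvature Ω q =
          ‖gradient ρ q‖⁻¹ * inner ℝ (fderiv ℝ (gradient ρ) q v) v := by
  have : Nontrivial (tangentPlane Ω q) := Module.nontrivial_of_finrank_eq_succ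
    (finrank_orthogonal_span_singleton_E3 (h.outwardNormal_ne_zero hq))
  have hpos : ∀ v : tangentPlane Ω q, 0 ≤ inner ℝ (shapeOperator Ω q v) v := by
    intro v
    rw [h.inner_shapeOperator hq]
    refine mul_nonneg (inv_nonneg.2 (norm_nonneg _)) (h.inner_fderiv_gradient_nonneg hq hΩ hΩo ?_)
    rw [← outwardNormal_eq hq h]
    exact mem_tangentPlane_iff.1 v.2
  obtain ⟨h1, h2⟩ := (h.shapeOperator_isSymmetric hq).sInf_eigenvalues_spec hpos
  change Module.End.HasEigenvalue _ (smallerPrincipalCurvature Ω q) at h1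
  change ∀ v, smallerPrincipalCurvature Ω q * ‖v‖ ^ 2 ≤ _ at h2
  obtain ⟨v, hv⟩ := h1.exists_hasEigenvector
  have hv0 : 0 < ‖v‖ := norm_pos_iff.2 hv.2
  have h3 : inner ℝ (shapeOperator Ω q v) v = smallerPrincipalCurvature Ω q * ‖v‖ ^ 2 := by
    rw [hv.apply_eq_smul, real_inner_smul_left, real_inner_self_eq_norm_sq]
  refine ⟨?_, ?_, ?_⟩
  · refine lt_of_le_of_ne ?_ fun h0 => ?_
    · have := hpos v
      rw [h3] at this
      exact nonneg_of_mul_nonneg_left this (by positivity)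
    · rw [← h0] at h1
      -- Only the nonvanishing of the determinant is needed here; the sign of the curvatures comes
      -- from convexity.
      exact hdet.ne' (((shapeOperator Ω q).hasEigenvalue_zero_tfae.out 0 3).1 h1)
  · intro v hv
    have := h2 ⟨v, mem_tangentPlane_iff.2 hv⟩
    rwa [h.inner_shapeOperator hq] at this
  · refine ⟨‖v‖⁻¹ • (v : E3), ?_, ?_, ?_⟩
    · rw [inner_smul_right, mem_tangentPlane_iff.1 v.2, mul_zero]
    · exact norm_smul_inv_norm (𝕜 := ℝ) (x := (v : E3)) (norm_pos_iff.1 hv0)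
    · rw [h.inner_shapeOperator hq] at h3
      rw [map_smul, real_inner_smul_left, inner_smul_right]
      field_simp at h3 ⊢
      linarith

/-- The chosen defining function may jump from point to point, but near `q` the normal is computed
by a single `ρ`. -/
theorem continuousOn_outwardNormal (hC : HasC2Boundary Ω) :
    ContinuousOn (outwardNormal Ω) (frontier Ω) := by
  intro q hq
  obtain ⟨ρ, h⟩ := hC q hq
  refine h.contDiffAt_unitGradient.continuousAt.continuousWithinAt.congr_of_eventuallyEq ?_
    (outwardNormal_eq hq h)
  filter_upwards [h.eventually.filter_mono nhdsWithin_le_nhds, self_mem_nhdsWithin] with x hx hxf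
  exact outwardNormal_eq hxf hx

theorem IsBoundedConvexDomain.isCompact_frontier (hΩ : IsBoundedConvexDomain Ω) :
    IsCompact (frontier Ω) :=
  hΩ.isBounded.isCompact_closure.of_isClosed_subset isClosed_frontier frontier_subset_closure

theorem IsBoundedConvexDomain.frontier_nonempty (hΩ : IsBoundedConvexDomain Ω) :
    (frontier Ω).Nonempty := by
  refine nonempty_frontier_iff.2 ⟨hΩ.nonempty, ?_⟩
  rintro rfl
  exact NormedSpace.unbounded_univ ℝ E3 hΩ.isBounded

/-- The smaller principal curvature attains its minimum. -/
theorem IsBoundedConvexDomain.exists_isLeast_smallerPrincipalCurvature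
    (hΩ : IsBoundedConvexDomain Ω) (hcurv : PositiveCurvatureCondition Ω) :
    ∃ k₀, IsLeast (smallerPrincipalCurvature Ω '' frontier Ω) k₀ := by
  -- The unit tangent bundle. Minimizing the second fundamental form over it avoids proving that k₁
  -- is continuous.
  set K : Set (E3 × E3) := (frontier Ω ×ˢ Metric.sphere (0 : E3) 1) ∩
    (fun z : E3 × E3 => (inner ℝ (outwardNormal Ω z.1) z.2 : ℝ)) ⁻¹' {0} with hK
  have hKc : IsCompact K := by
    have h1 : IsCompact (frontier Ω ×ˢ Metric.sphere (0 : E3) 1) :=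
      hΩ.isCompact_frontier.prod (isCompact_sphere _ _)
    refine h1.of_isClosed_subset ?_ inter_subset_left
    refine ContinuousOn.preimage_isClosed_of_isClosed ?_ h1.isClosed isClosed_singleton
    exact ((continuousOn_outwardNormal hcurv.hasC2Boundary).comp continuousOn_fst
      fun z hz => hz.1).inner continuousOn_snd
  set F : E3 × E3 → ℝ := fun z =>
    inner ℝ (fderiv ℝ (unitGradient (localDefiningFunction Ω z.1)) z.1 z.2) z.2 with hF
  have hFρ : ∀ z ∈ K, ∀ ρ, IsLocalDefiningFunction Ω z.1 ρ →
      F z = inner ℝ (fderiv ℝ (unitGradient ρ) z.1 z.2) z.2 := by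
    intro z hz ρ h
    have h1 : inner ℝ (unitGradient ρ z.1) z.2 = 0 := by
      rw [← outwardNormal_eq hz.1.1 h]; exact hz.2
    rw [h.fderiv_unitGradient_eq (localDefiningFunction_spec h) (h.eq_zero hz.1.1) h1]
  have hFc : ContinuousOn F K := by
    intro z hz
    obtain ⟨ρ, h⟩ := hcurv.hasC2Boundary z.1 hz.1.1
    have h1 : ContinuousAt (fderiv ℝ (unitGradient ρ)) z.1 :=
      (h.contDiffAt_unitGradient.fderiv_right (m := 0) (by norm_num)).continuousAt
    have h2 : ContinuousAt
        (fun z : E3 × E3 => (inner ℝ (fderiv ℝ (unitGradient ρ) z.1 z.2) z.2 : ℝ)) z :=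
      ((h1.comp continuousAt_fst).clm_apply continuousAt_snd).inner continuousAt_snd
    refine h2.continuousWithinAt.congr_of_eventuallyEq ?_ (hFρ z hz ρ h)
    have h3 : ∀ᶠ y in 𝓝 z, IsLocalDefiningFunction Ω y.1 ρ :=
      continuousAt_fst.eventually h.eventually
    filter_upwards [h3.filter_mono nhdsWithin_le_nhds, self_mem_nhdsWithin] with y hy hyK
    exact hFρ y hyK ρ hy
  have hFK : ∀ z ∈ K, ∀ ρ, IsLocalDefiningFunction Ω z.1 ρ →
      F z = ‖gradient ρ z.1‖⁻¹ * inner ℝ (fderiv ℝ (gradient ρ) z.1 z.2) z.2 := by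
    intro z hz ρ h
    rw [hFρ z hz ρ h, h.inner_fderiv_unitGradient]
    rw [← outwardNormal_eq hz.1.1 h]
    exact hz.2
  have hmin : ∀ q ∈ frontier Ω, ∃ v, (q, v) ∈ K ∧ smallerPrincipalCurvature Ω q = F (q, v) := by
    intro q hq
    obtain ⟨ρ, h⟩ := hcurv.hasC2Boundary q hq
    obtain ⟨v, h1, h2, h3⟩ := (h.smallerPrincipalCurvature_spec hq hΩ.convex hΩ.isOpen
      (hcurv.gaussianCurvature_pos q hq)).2.2
    have hv : (q, v) ∈ K := ⟨⟨hq, by simpa using h2⟩, h1⟩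
    exact ⟨v, hv, h3.trans (hFK _ hv ρ h).symm⟩
  obtain ⟨q, hq⟩ := hΩ.frontier_nonempty
  obtain ⟨v, hv, -⟩ := hmin q hq
  obtain ⟨z, hz, hzmin⟩ := hKc.exists_isMinOn ⟨_, hv⟩ hFc
  refine ⟨smallerPrincipalCurvature Ω z.1, mem_image_of_mem _ hz.1.1, ?_⟩
  rintro _ ⟨p, hp, rfl⟩
  obtain ⟨w, hw, hwF⟩ := hmin p hp
  obtain ⟨ρ, h⟩ := hcurv.hasC2Boundary z.1 hz.1.1
  have h1 := (h.smallerPrincipalCurvature_spec hz.1.1 hΩ.convex hΩ.isOpen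
    (hcurv.gaussianCurvature_pos _ hz.1.1)).2.1 z.2 hz.2
  have h2 : ‖z.2‖ = 1 := by simpa using hz.1.2
  rw [h2, one_pow, mul_one, ← hFK z hz ρ h] at h1
  rw [hwF]
  exact h1.trans (hzmin hw)

/-! ### Global sphere conditions -/

/-- Every `R` exceeding the inverse of a positive lower bound of the principal curvatures is an
admissible radius in the sphere-enclosing condition. -/
theorem IsBoundedConvexDomain.sphereEnclosingConditionWith (hΩ : IsBoundedConvexDomain Ω)
    (hcurv : PositiveCurvatureCondition Ω) {k R : ℝ} (hk : 0 < k)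
    (hle : ∀ q ∈ frontier Ω, k ≤ smallerPrincipalCurvature Ω q) (hR : 1 / k < R) :
    SphereEnclosingConditionWith Ω R := by
  have hR0 : 0 < R := (by positivity : (0 : ℝ) < 1 / k).trans hR
  intro q hq
  obtain ⟨ρ, h⟩ := hcurv.hasC2Boundary q hq
  have hn := h.norm_unitGradient
  have hmax : ∀ x ∈ closure Ω, inner ℝ x (unitGradient ρ q) ≤ inner ℝ q (unitGradient ρ q) := by
    intro x hx
    refine closure_minimal (t := {x : E3 | inner ℝ x (unitGradient ρ q) ≤
      inner ℝ q (unitGradient ρ q)}) (fun y hy => ?_)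
      (isClosed_le (by fun_prop) continuous_const) hx
    have h1 := h.inner_gradient_sub_nonpos hq hΩ.convex hΩ.isOpen hy
    rw [h.gradient_eq_smul, real_inner_smul_left] at h1
    have h2 := nonpos_of_mul_nonpos_right h1 h.norm_gradient_pos
    rw [inner_sub_right, real_inner_comm, real_inner_comm q] at h2
    exact sub_nonpos.1 h2
  obtain ⟨w, hw, hnw⟩ := exists_ne_zero_inner_eq_zero (v := unitGradient ρ q)
    (by rw [← norm_ne_zero_iff, hn]; exact one_ne_zero)
  refine ⟨q - R • unitGradient ρ q, ?_, ?_⟩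
  · have hsub : closure Ω ⊆ Metric.closedBall (q - R • unitGradient ρ q) R := by
      refine subset_closedBall_of_local hΩ.convex.closure hΩ.isBounded.isCompact_closure hR0 ?_ hn
        hq.1 hmax hw hnw
      intro n hn p hp hpmax
      -- At an interior point, a small move along `n` would increase the functional.
      have hpf : p ∈ frontier Ω := by
        refine ⟨hp, fun hpi => ?_⟩
        have hline : Tendsto (fun t : ℝ => p + t • n) (𝓝[>] 0) (𝓝 p) := by
          have : Continuous fun t : ℝ => p + t • n := by fun_prop
          simpa using (this.tendsto 0).mono_left nhdsWithin_le_nhds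
        obtain ⟨t, h1, ht⟩ := ((hline.eventually (mem_interior_iff_mem_nhds.1 hpi)).and
          (self_mem_nhdsWithin : ∀ᶠ t in 𝓝[>] (0 : ℝ), 0 < t)).exists
        have h2 := hpmax _ (subset_closure h1)
        rw [inner_add_left, real_inner_smul_left, real_inner_self_eq_norm_sq, hn] at h2
        linarith
      obtain ⟨σ, hσ⟩ := hcurv.hasC2Boundary p hpf
      have hσn := hσ.unitGradient_eq_of_isMaxOn hpf hn fun x hx => hpmax x (subset_closure hx)
      rw [← hσn]
      refine hσ.eventually_mem_closedBall hpf hΩ.convex hΩ.isOpen hk hR fun v hv => ?_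
      rw [← outwardNormal_eq hpf hσ] at hv
      have h1 := (hσ.smallerPrincipalCurvature_spec hpf hΩ.convex hΩ.isOpen
        (hcurv.gaussianCurvature_pos p hpf)).2.1 v hv
      have h2 := (mul_le_mul_of_nonneg_right (hle p hpf) (sq_nonneg ‖v‖)).trans h1
      rw [inv_mul_eq_div, le_div_iff₀ hσ.norm_gradient_pos] at h2
      linarith
    rw [← interior_closedBall _ hR0.ne']
    exact interior_maximal (subset_closure.trans hsub) hΩ.isOpen
  · rw [mem_sphere_iff_norm, sub_sub_cancel, norm_smul, hn, mul_one, Real.norm_of_nonneg hR0.le]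

theorem HasC2Boundary.uniformInteriorSphereCondition (hC : HasC2Boundary Ω)
    (hcpt : IsCompact (frontier Ω)) : UniformInteriorSphereCondition Ω := by
  -- Quantifying over all radii up to `r₀` lets a union take the smaller bound. The repeated
  -- membership arises because the compactness induction replaces the first `frontier Ω` by
  -- arbitrary sets.
  have key : ∃ r₀ : ℝ, 0 < r₀ ∧ ∀ p ∈ frontier Ω, p ∈ frontier Ω → ∀ r, 0 < r → r ≤ r₀ →
      Metric.ball (p - r • outwardNormal Ω p) r ⊆ Ω := by
    refine hcpt.induction_on (p := fun s => ∃ r₀ : ℝ, 0 < r₀ ∧ ∀ p ∈ s, p ∈ frontier Ω → ∀ r,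
      0 < r → r ≤ r₀ → Metric.ball (p - r • outwardNormal Ω p) r ⊆ Ω) ⟨1, one_pos, by simp⟩ ?_ ?_ ?_
    · rintro s t hst ⟨r₀, h0, h⟩
      exact ⟨r₀, h0, fun p hp => h p (hst hp)⟩
    · rintro s t ⟨r₁, h1, hs⟩ ⟨r₂, h2, ht⟩
      refine ⟨min r₁ r₂, lt_min h1 h2, ?_⟩
      rintro p (hp | hp) hpf r hr hle
      · exact hs p hp hpf r hr (hle.trans (min_le_left _ _))
      · exact ht p hp hpf r hr (hle.trans (min_le_right _ _))
    · intro q hq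
      obtain ⟨ρ, h⟩ := hC q hq
      obtain ⟨r₀, h0, hev⟩ := h.eventually_ball_subset
      exact ⟨_, mem_nhdsWithin_of_mem_nhds hev, r₀, h0, fun p hp => hp⟩
  obtain ⟨r, hr, H⟩ := key
  refine ⟨r, hr, fun q hq => ⟨_, H q hq hq r hr le_rfl, ?_⟩⟩
  obtain ⟨ρ, h⟩ := hC q hq
  rw [mem_sphere_iff_norm, sub_sub_cancel, norm_smul, outwardNormal_eq hq h, h.norm_unitGradient,
    mul_one, Real.norm_of_nonneg hr.le]

end Boundary

theorem mainTheorem11 (Ω : Set E3) (hΩ : IsBoundedConvexDomain Ω)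
    (hcurv : PositiveCurvatureCondition Ω) :
    UniformInteriorSphereCondition Ω ∧
    UniformSphereEnclosingCondition Ω ∧
    ∃ k₀ : ℝ, IsLeast (smallerPrincipalCurvature Ω '' frontier Ω) k₀ ∧ 0 < k₀ ∧
      ∀ R : ℝ, 1 / k₀ < R → SphereEnclosingConditionWith Ω R := by
  obtain ⟨k₀, hk₀⟩ := hΩ.exists_isLeast_smallerPrincipalCurvature hcurv
  have hpos : 0 < k₀ := by
    obtain ⟨q, hq, rfl⟩ := hk₀.1
    obtain ⟨ρ, h⟩ := hcurv.hasC2Boundary q hq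
    exact (h.smallerPrincipalCurvature_spec hq hΩ.convex hΩ.isOpen
      (hcurv.gaussianCurvature_pos q hq)).1
  have henc : ∀ R : ℝ, 1 / k₀ < R → SphereEnclosingConditionWith Ω R := fun R hR =>
    hΩ.sphereEnclosingConditionWith hcurv hpos (fun q hq => hk₀.2 (mem_image_of_mem _ hq)) hR
  exact ⟨hcurv.hasC2Boundary.uniformInteriorSphereCondition hΩ.isCompact_frontier,
    ⟨1 / k₀ + 1, by positivity, henc _ (lt_add_one _)⟩, k₀, hk₀, hpos, henc⟩
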